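/- A graph of groups $\Lambda$ consists of a nonempty connected graph (loops and multiple edges allowed) with vertex set $V(\Lambda)$, edge set $E(\Lambda)$ and endpoint maps $\iota,\tau:E(\Lambda)\to V(\Lambda)$, a group $\Lambda(V)$ for each vertex $V$, a subgroup $\Lambda(E)\le\Lambda(\iota(E))$ for each edge $E$, and an injective homomorphism $\Lambda(E)\to\Lambda(\tau(E))$, $g\mapsto g^{t_E}$, called the edge map, for each edge $E$. Its fundamental group $\pi_1(\Lambda)$, with respect to a spanning tree $T$ of the graph, is the group generated by the disjoint union of the vertex groups and symbols $t_E$ $(E\in E(\Lambda))$, subject to the relations of the vertex groups, $g\,t_E=t_E\,g^{t_E}$ for $E\in E(\Lambda)$ and $g\in\Lambda(E)$, and $t_E=1$ for $E\in T$. Vertex and edge groups are identified with their images in $\pi_1(\Lambda)$ (for an edge group: through $\Lambda(E)\le\Lambda(\iota(E))$). Let $(W,S)$ be a Coxeter system ($S$ possibly infinite). A special subgroup of $W$ is a subgroup generated by a subset of $S$. A visual graph of groups decomposition of $W$ is a graph of groups $\Psi$ whose vertex and edge groups are special subgroups of $W$, with the group of each edge contained in the groups of both its endpoints and the edge maps given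 by inclusion, such that the inclusions of the vertex groups in $W$ extend to an isomorphism $\pi_1(\Psi)\cong W$. Theorem. Let $(W,S)$ be a Coxeter system and suppose that $W$ is a subgroup of the fundamental group $\pi_1(\Lambda)$ of a graph of groups $\Lambda$. Then $W$ has a visual graph of groups decomposition $\Psi$ such that 1. each vertex group of $\Psi$ is a subgroup of a conjugate, in $\pi_1(\Lambda)$, of a vertex group of $\Lambda$; 2. each edge group of $\Psi$ is a subgroup of a conjugate, in $\pi_1(\Lambda)$, of an edge group of $\Lambda$; 3. each special subgroup of $W$ that is a subgroup of a conjugate, in $\pi_1(\Lambda)$, of a vertex group of $\Lambda$ is a subgroup of a vertex group of $\Psi$. -/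

import Mathlib

/-- A nonempty connected graph given by a vertex set, an edge set and the two endpoint maps
(loops and multiple edges are allowed). -/
structure ConnectedMultigraph.{u, v} where
  /-- The vertices. -/
  V : Type u
  /-- The edges. -/
  E : Type v
  /-- The originating vertex of an edge. -/
  source : E → V
  /-- The terminating vertex of an edge. -/
  target : E → V
  /-- Any two vertices are joined by an undirected path, and there is a vertex. -/
  connected : (SimpleGraph.fromRel fun x y => ∃ e, source e = x ∧ target e = y).Connected

namespace ConnectedMultigraph

/-- A set of edges is a spanning tree if, together with all vertices, it forms a tree:
it has no loops, no two of its edges have the same pair of endpoints, and the simple graph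
which it therefore is is a tree. -/
structure IsSpanningTree.{u, v} (X : ConnectedMultigraph.{u, v}) (T : Set X.E) : Prop where
  no_loops : ∀ e ∈ T, X.source e ≠ X.target e
  no_multiple : Set.InjOn (fun e => s(X.source e, X.target e)) T
  isTree : (SimpleGraph.fromRel fun x y => ∃ e ∈ T, X.source e = x ∧ X.target e = y).IsTree

end ConnectedMultigraph

/-- A graph of groups: every edge group is a subgroup of the group at its originating vertex and
has an injective homomorphism, the edge map, to the group at its terminating vertex. -/
structure GraphOfGroups.{u, v, w} extends ConnectedMultigraph.{u, v} where
  /-- The vertex groups. -/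
  vertexGroup : V → Type w
  [group : ∀ x, Group (vertexGroup x)]
  /-- The edge groups. -/
  edgeGroup : ∀ e, Subgroup (vertexGroup (source e))
  /-- The edge maps. -/
  edgeMap : ∀ e, edgeGroup e →* vertexGroup (target e)
  edgeMap_injective : ∀ e, Function.Injective (edgeMap e)

attribute [instance] GraphOfGroups.group

namespace GraphOfGroups

universe u v w

/-- The generators of the fundamental group: the disjoint union of the vertex groups, and one
symbol for each edge. -/
abbrev Generator (L : GraphOfGroups.{u, v, w}) : Type (max u v w) :=
  (Σ x : L.V, L.vertexGroup x) ⊕ L.E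

/-- The generator of the free group given by an element of a vertex group. -/
def vertexLetter (L : GraphOfGroups.{u, v, w}) (x : L.V) (g : L.vertexGroup x) :
    FreeGroup L.Generator :=
  FreeGroup.of (Sum.inl ⟨x, g⟩)

/-- The generator of the free group given by an edge. -/
def edgeLetter (L : GraphOfGroups.{u, v, w}) (e : L.E) : FreeGroup L.Generator :=
  FreeGroup.of (Sum.inr e)

/-- The relators of the fundamental group with respect to a set `T` of edges: those of every
vertex group, `g t_e = t_e g^{t_e}` for `g` in the edge group of `e`, and `t_e = 1` for `e ∈ T`. -/
inductive Relator (L : GraphOfGroups.{u, v, w}) (T : Set L.E) : FreeGroup L.Generator → Prop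
  | vertex (x : L.V) (g h : L.vertexGroup x) :
      Relator L T (L.vertexLetter x g * L.vertexLetter x h * (L.vertexLetter x (g * h))⁻¹)
  | edge (e : L.E) (g : L.edgeGroup e) :
      Relator L T (L.vertexLetter (L.source e) g * L.edgeLetter e *
        (L.edgeLetter e * L.vertexLetter (L.target e) (L.edgeMap e g))⁻¹)
  | tree (e : L.E) (he : e ∈ T) : Relator L T (L.edgeLetter e)

/-- The fundamental group of a graph of groups with respect to a spanning tree `T`. -/
abbrev FundamentalGroup (L : GraphOfGroups.{u, v, w}) (T : Set L.E) : Type (max u v w) :=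
  PresentedGroup {r | L.Relator T r}

/-- The canonical homomorphism from a vertex group to the fundamental group. -/
def ofVertex (L : GraphOfGroups.{u, v, w}) (T : Set L.E) (x : L.V) :
    L.vertexGroup x →* L.FundamentalGroup T :=
  MonoidHom.mk' (fun g => PresentedGroup.mk {r | L.Relator T r} (L.vertexLetter x g)) (by
    intro g h
    have hr : PresentedGroup.mk {r | L.Relator T r}
        (L.vertexLetter x g * L.vertexLetter x h * (L.vertexLetter x (g * h))⁻¹) = 1 :=
      PresentedGroup.one_of_mem (Relator.vertex x g h)
    rw [map_mul, map_mul, map_inv, mul_inv_eq_one] at hr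
    exact hr.symm)

/-- A vertex group as a subgroup of the fundamental group. -/
def vertexSubgroup (L : GraphOfGroups.{u, v, w}) (T : Set L.E) (x : L.V) :
    Subgroup (L.FundamentalGroup T) :=
  (L.ofVertex T x).range

/-- An edge group as a subgroup of the fundamental group. -/
def edgeSubgroup (L : GraphOfGroups.{u, v, w}) (T : Set L.E) (e : L.E) :
    Subgroup (L.FundamentalGroup T) :=
  (L.edgeGroup e).map (L.ofVertex T (L.source e))

end GraphOfGroups

/-- `H` is contained in the conjugate `g K g⁻¹` of `K` for some `g`. -/
def Subgroup.LiesInConjugate {G : Type*} [Group G] (H K : Subgroup G) : Prop :=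
  ∃ g : G, H ≤ K.map (MulAut.conj g).toMonoidHom

/-- A special subgroup of a Coxeter system `(W, S)`: one that is generated by a subset of `S`. -/
def CoxeterSystem.IsSpecial {B W : Type*} [Group W] {M : CoxeterMatrix B}
    (cs : CoxeterSystem M W) (H : Subgroup W) : Prop :=
  ∃ J : Set B, H = Subgroup.closure (cs.simple '' J)

/-- A connected graph with a subgroup of `W` at every vertex and at every edge, the group of an
edge being contained in the groups of both endpoints. -/
structure GraphOfSubgroups.{u, v, w} (W : Type w) [Group W] extends
    ConnectedMultigraph.{u, v} where
  /-- The vertex groups. -/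
  vertexGroup : V → Subgroup W
  /-- The edge groups. -/
  edgeGroup : E → Subgroup W
  le_source : ∀ e, edgeGroup e ≤ vertexGroup (source e)
  le_target : ∀ e, edgeGroup e ≤ vertexGroup (target e)

namespace GraphOfSubgroups

universe u v w

/-- The graph of groups whose vertex and edge groups are the given subgroups and whose edge maps
are the inclusions. -/
def toGraphOfGroups {W : Type w} [Group W] (P : GraphOfSubgroups.{u, v, w} W) :
    GraphOfGroups.{u, v, w} where
  toConnectedMultigraph := P.toConnectedMultigraph
  vertexGroup x := P.vertexGroup x
  edgeGroup e := (P.edgeGroup e).subgroupOf (P.vertexGroup (P.source e))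
  edgeMap e := MonoidHom.mk' (fun g => ⟨((g : P.vertexGroup (P.source e)) : W),
    P.le_target e (Subgroup.mem_subgroupOf.1 g.2)⟩) (fun _ _ => rfl)
  edgeMap_injective e := fun a b h => by
    have h' : ((a : P.vertexGroup (P.source e)) : W) = (b : P.vertexGroup (P.source e)) :=
      congrArg (fun z : P.vertexGroup (P.target e) => (z : W)) h
    exact Subtype.ext (Subtype.ext h')

/-- A visual graph of groups decomposition of `W` for the Coxeter system `cs`: the vertex and edge
groups are special, the edge maps are inclusions, and the inclusions of the vertex groups in `W`
extend to an isomorphism of the fundamental group with `W`. -/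
structure IsVisualDecomposition {B : Type*} {W : Type w} [Group W] {M : CoxeterMatrix B}
    (cs : CoxeterSystem M W) (P : GraphOfSubgroups.{u, v, w} W) : Prop where
  vertex_special : ∀ x, cs.IsSpecial (P.vertexGroup x)
  edge_special : ∀ e, cs.IsSpecial (P.edgeGroup e)
  exists_mulEquiv : ∃ T : Set P.E, P.IsSpanningTree T ∧
    ∃ f : P.toGraphOfGroups.FundamentalGroup T ≃* W,
      ∀ (x : P.V) (g : P.vertexGroup x), f (P.toGraphOfGroups.ofVertex T x g) = g

end GraphOfSubgroups

universe u v w b k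

/-! Through `i`, the Coxeter group acts without inversions on the Bass–Serre tree of `L`, whose
vertices and edges are the cosets of the vertex and edge groups. The graph of `P` is this whole
tree, not its quotient; the group at a vertex or edge is generated by the simple reflections that
fix it. Since stabilizers are conjugates of vertex and edge groups, the three containment conditions
are immediate (`Subgroup.mem_map_conj_iff_smul_coset`).

The substance is that the fundamental group of `P` is the Coxeter group
(`exists_fixerGroup_mulEquiv`). All edge letters are trivial, so this group is the amalgam of the
vertex groups. The fixed set of a simple reflection is nonempty and connected, so its copies in the
vertex groups coincide in the amalgam. Two reflections with a finite-order product generate a finite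
group, which fixes a vertex, so their Coxeter relation already holds in a vertex group.

That the Bass–Serre graph is a tree is proved cohomologically: every edge cochain is a coboundary
(`exists_potential`), so the indicator of one edge yields a two-colouring of the vertices that
changes across that edge only. -/

namespace SimpleGraph

/-! ### Trees: convexity of distance and fixed vertices of automorphisms. -/

variable {V : Type*} {G : SimpleGraph V}

/-- In a tree, at most one neighbour of a vertex `b` is closer to a given vertex than `b`. -/
theorem IsTree.eq_of_adj_of_dist_lt (hG : G.IsTree) {p a b c : V} (ha : G.Adj b a)
    (hc : G.Adj b c) (hda : G.dist a p < G.dist b p) (hdc : G.dist c p < G.dist b p) :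
    a = c := by
  -- A closer neighbour is the second vertex of a path from `b` to `p`, and such a path is unique.
  have key : ∀ {a : V}, G.Adj b a → G.dist a p < G.dist b p →
      ∃ w : G.Walk b p, w.IsPath ∧ w.snd = a := by
    intro a ha hd
    obtain ⟨w, hw⟩ := hG.connected.exists_walk_length_eq_dist a p
    refine ⟨.cons ha w, Walk.isPath_of_length_eq_dist _ ?_, by simp⟩
    refine le_antisymm ?_ (dist_le _)
    simp only [Walk.length_cons]
    omega
  obtain ⟨w, hw, rfl⟩ := key ha hda
  obtain ⟨w', hw', rfl⟩ := key hc hdc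
  rw [(hG.existsUnique_path b p).unique hw hw']

/-- Squared distances from a vertex of a tree are strictly convex along paths. -/
theorem IsTree.two_mul_dist_sq_lt (hG : G.IsTree) (p : V) {a b c : V} (ha : G.Adj b a)
    (hc : G.Adj b c) (hac : a ≠ c) :
    2 * G.dist p b ^ 2 < G.dist p a ^ 2 + G.dist p c ^ 2 := by
  have h1 := hG.dist_eq_dist_add_one_of_adj p ha
  have h2 := hG.dist_eq_dist_add_one_of_adj p hc
  have h3 := fun h h' => hac (hG.eq_of_adj_of_dist_lt (p := p) ha hc h h')
  rw [G.dist_comm (u := a), G.dist_comm (u := b), G.dist_comm (u := c)] at h3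
  rcases h1 with h1 | h1 <;> rcases h2 with h2 | h2
  · exact (h3 (by omega) (by omega)).elim
  · rw [h2, h1]; nlinarith
  · rw [h1, h2]; nlinarith
  · rw [h1, h2]; nlinarith

/-- A function that is strictly convex along paths and does not decrease on the first edge of a
path is larger at the end of the path, if the path has length at least two. -/
theorem Walk.IsPath.lt_of_strictly_convex {f : V → ℕ}
    (hf : ∀ a b c, G.Adj b a → G.Adj b c → a ≠ c → 2 * f b < f a + f c) {v w : V}
    (q : G.Walk v w) : ∀ {u : V} (h : G.Adj u v), (Walk.cons h q).IsPath → f u ≤ f v →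
      v ≠ w → f v < f w := by
  induction q with
  | nil => intro u h _ _ hne; exact (hne rfl).elim
  | @cons v v' w h' q ih =>
    intro u h hp hle _
    have huv' : u ≠ v' := by
      rintro rfl
      simp [Walk.cons_isPath_iff] at hp
    have hlt : f v < f v' := by
      have := hf u v v' h.symm h' huv'
      omega
    by_cases hw : v' = w
    · exact hw ▸ hlt
    · exact hlt.trans (ih h' ((Walk.cons_isPath_iff _ _).1 hp).1 hlt.le hw)

section Action

variable {K : Type*} [Group K] [MulAction K V]

theorem dist_smul (hadj : ∀ (k : K) a b, G.Adj a b → G.Adj (k • a) (k • b)) (hG : G.Connected)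
    (k : K) (a b : V) : G.dist (k • a) (k • b) = G.dist a b := by
  have key : ∀ (k : K) a b, G.dist (k • a) (k • b) ≤ G.dist a b := by
    intro k a b
    obtain ⟨w, hw⟩ := hG.exists_walk_length_eq_dist a b
    rw [← hw, ← w.length_map (⟨fun v => k • v, fun h => hadj k _ _ h⟩ : G →g G)]
    exact dist_le _
  refine le_antisymm (key k a b) ?_
  simpa using key k⁻¹ (k • a) (k • b)

/-- A finite group acting on a tree without inversions fixes a vertex. -/
theorem IsTree.exists_forall_smul_eq [Finite K] (hG : G.IsTree)
    (hadj : ∀ (k : K) a b, G.Adj a b → G.Adj (k • a) (k • b))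
    (hinv : ∀ (k : K) a b, G.Adj a b → k • a = b → k • b ≠ a) : ∃ v : V, ∀ k : K, k • v = v := by
  have := Fintype.ofFinite K
  obtain ⟨v₀⟩ := hG.connected.nonempty
  -- A minimum of this invariant function is a centre of the orbit of `v₀`. Squaring makes the
  -- convexity strict: distance alone is linear along geodesics.
  let f : V → ℕ := fun v => ∑ k : K, G.dist (k • v₀) v ^ 2
  have hf : ∀ a b c, G.Adj b a → G.Adj b c → a ≠ c → 2 * f b < f a + f c := by
    intro a b c ha hc hac
    simp only [f, Finset.mul_sum, ← Finset.sum_add_distrib]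
    exact Finset.sum_lt_sum_of_nonempty Finset.univ_nonempty
      fun k _ => hG.two_mul_dist_sq_lt _ ha hc hac
  have hfK : ∀ (k : K) v, f (k • v) = f v := by
    intro k v
    simp only [f]
    rw [← Equiv.sum_comp (Equiv.mulLeft k)]
    refine Finset.sum_congr rfl fun l _ => ?_
    rw [Equiv.coe_mulLeft, mul_smul, dist_smul hadj hG.connected]
  obtain ⟨a, ha⟩ : ∃ a, ∀ v, f a ≤ f v := by
    have hne : (Set.range f).Nonempty := ⟨_, v₀, rfl⟩
    obtain ⟨a, ha⟩ := Nat.sInf_mem hne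
    exact ⟨a, fun v => ha ▸ Nat.sInf_le ⟨v, rfl⟩⟩
  -- On a path of length at least two starting at a minimum, strict convexity would make the far end
  -- larger.
  have hclose : ∀ b c, f b = f a → f c = f a → b ≠ c → G.Adj b c := by
    intro b c hb hc hbc
    obtain ⟨p, hp, -⟩ := hG.existsUnique_path b c
    cases p with
    | nil => exact (hbc rfl).elim
    | @cons _ v _ h q =>
      by_cases hv : v = c
      · exact hv ▸ h
      · have := Walk.IsPath.lt_of_strictly_convex hf q h hp (hb ▸ ha v) hv
        have := ha v
        omega
  by_contra! hcon
  obtain ⟨k, hk⟩ := hcon a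
  have hab : G.Adj a (k • a) := hclose _ _ rfl (hfK k a) hk.symm
  -- A third minimum in the orbit would contradict convexity at `k • a`; without one, `k` swaps the
  -- ends of an edge.
  by_cases hb : ∃ l : K, l • (k • a) ≠ k • a ∧ l • k • a ≠ a
  · obtain ⟨l, hl1, hl2⟩ := hb
    have e1 : f (l • k • a) = f a := by rw [hfK, hfK]
    have h1 := hclose _ _ (hfK k a) e1 hl1.symm
    have h2 := hclose _ _ rfl e1 hl2.symm
    have := hf a (k • a) (l • k • a) hab.symm h1 hl2.symm
    have := hfK k a
    omega
  · push Not at hb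
    have h1 := hb k (fun h => hk (by simpa using h))
    exact hinv k a _ hab rfl h1

/-- The vertices fixed by a tree automorphism are joined by paths of fixed vertices. -/
theorem IsTree.fixed_induction (hG : G.IsTree) {k : K}
    (hadj : ∀ (k : K) a b, G.Adj a b → G.Adj (k • a) (k • b)) {p : V → V → Prop}
    (refl : ∀ a, p a a)
    (step : ∀ a b c, G.Adj a b → k • a = a → k • b = b → p b c → p a c) {a b : V}
    (ha : k • a = a) (hb : k • b = b) : p a b := by
  induction hn : G.dist a b generalizing a with
  | zero =>
    rw [hG.connected.dist_eq_zero_iff] at hn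
    exact hn ▸ refl a
  | succ n ih =>
    obtain ⟨w, hw⟩ := hG.connected.exists_walk_length_eq_dist a b
    cases w with
    | nil => simp at hn
    | @cons _ v _ h q =>
      have hv : G.dist v b = n := by
        have h1 := dist_le q
        have h2 := hG.dist_eq_dist_add_one_of_adj b h
        rw [G.dist_comm (u := b), G.dist_comm (u := b)] at h2
        simp only [Walk.length_cons] at hw
        omega
      -- Both `v` and `k • v` are neighbours of `a` closer to `b`, so they agree.
      have hkv : k • v = v := by
        have h1 : G.dist (k • v) b = n := by
          rw [← hv]
          conv_lhs => rw [← hb]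
          exact dist_smul hadj hG.connected k v b
        have h2 := hadj k a v h
        rw [ha] at h2
        exact hG.eq_of_adj_of_dist_lt (p := b) h2 h (by omega) (by omega)
      exact step _ _ _ h ha hkv (ih hkv hv)

end Action

end SimpleGraph

/-! ### Finite dihedral groups. -/

/-- Two involutions whose product has finite order generate a finite group. -/
theorem Subgroup.finite_closure_pair_of_isOfFinOrder {G : Type*} [Group G] {s t : G}
    (hs : s * s = 1) (ht : t * t = 1) (h : IsOfFinOrder (s * t)) :
    Finite (Subgroup.closure {s, t}) := by
  set c := s * t with hc
  have hsi : s⁻¹ = s := inv_eq_of_mul_eq_one_right hs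
  have hti : t⁻¹ = t := inv_eq_of_mul_eq_one_right ht
  have htc : t = s * c := by rw [hc, ← mul_assoc, hs, one_mul]
  have hconj : ∀ x ∈ Subgroup.zpowers c, s * x * s ∈ Subgroup.zpowers c := by
    rintro _ ⟨k, rfl⟩
    refine ⟨-k, ?_⟩
    have h1 : s * c * s⁻¹ = c⁻¹ := by
      rw [hc, mul_inv_rev, hsi, hti, ← mul_assoc, hs, one_mul]
    have h2 : s * c ^ k * s⁻¹ = c ^ (-k) := by
      rw [← conj_zpow, h1, inv_zpow, zpow_neg]
    rw [hsi] at h2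
    exact h2.symm
  -- The rotations and reflections of the dihedral group: a finite set closed under left
  -- multiplication by the generators.
  let A : Set G := (Subgroup.zpowers c : Set G) ∪ (· * s) '' (Subgroup.zpowers c : Set G)
  have hfin : A.Finite := by
    have : (Subgroup.zpowers c : Set G).Finite := h.finite_zpowers
    exact this.union (this.image _)
  have hA : ∀ y ∈ A, s * y ∈ A := by
    rintro y (hy | ⟨y, hy, rfl⟩)
    · exact Or.inr ⟨_, hconj y hy, by simp [mul_assoc, hs]⟩
    · exact Or.inl (by simpa [mul_assoc] using hconj y hy)
  have hB : ∀ y ∈ A, c * y ∈ A := by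
    rintro y (hy | ⟨y, hy, rfl⟩)
    · exact Or.inl (mul_mem (Subgroup.mem_zpowers c) hy)
    · exact Or.inr ⟨_, mul_mem (Subgroup.mem_zpowers c) hy, by simp [mul_assoc]⟩
  have hst : ∀ x ∈ ({s, t} : Set G), ∀ y ∈ A, x * y ∈ A := by
    rintro x (rfl | rfl) y hy
    · exact hA y hy
    · rw [htc, mul_assoc]; exact hA _ (hB y hy)
  refine hfin.subset fun x hx => ?_
  induction hx using Subgroup.closure_induction_left with
  | one => exact Or.inl (one_mem _)
  | mul_left x hx y hy ih => exact hst x hx y ih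
  | inv_mul_cancel x hx y hy ih =>
    have : x⁻¹ = x := by rcases hx with rfl | rfl <;> assumption
    rw [this]
    exact hst x hx y ih

/-! ### Group actions on oriented trees. -/

namespace ConnectedMultigraph

/-- The simple graph underlying a multigraph. -/
def toSimpleGraph (X : ConnectedMultigraph) : SimpleGraph X.V :=
  SimpleGraph.fromRel fun x y => ∃ e, X.source e = x ∧ X.target e = y

/-- A multigraph is a tree if the set of all its edges is a spanning tree. -/
abbrev IsTree (X : ConnectedMultigraph) : Prop := X.IsSpanningTree Set.univ

theorem IsTree.toSimpleGraph {X : ConnectedMultigraph} (hX : X.IsTree) :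
    X.toSimpleGraph.IsTree := by
  simpa [ConnectedMultigraph.toSimpleGraph] using hX.isTree

theorem IsTree.edge_ext {X : ConnectedMultigraph} (hX : X.IsTree) {d e : X.E}
    (h : s(X.source d, X.target d) = s(X.source e, X.target e)) : d = e :=
  hX.no_multiple (Set.mem_univ _) (Set.mem_univ _) h

theorem toSimpleGraph_adj (X : ConnectedMultigraph) {x y : X.V} :
    X.toSimpleGraph.Adj x y ↔
      x ≠ y ∧ ∃ e, s(X.source e, X.target e) = s(x, y) := by
  simp only [toSimpleGraph, SimpleGraph.fromRel_adj, Sym2.eq_iff, exists_or]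

/-- An action of a group on a multigraph. -/
class GroupAction (X : ConnectedMultigraph) (W : Type*) [Group W] [MulAction W X.V]
    [MulAction W X.E] : Prop where
  source_smul : ∀ (w : W) e, X.source (w • e) = w • X.source e
  target_smul : ∀ (w : W) e, X.target (w • e) = w • X.target e

section Action

open GroupAction

variable (X : ConnectedMultigraph) {W : Type*} [Group W] [MulAction W X.V] [MulAction W X.E]
  [X.GroupAction W]

theorem smul_adj (w : W) (x y : X.V) (h : X.toSimpleGraph.Adj x y) :
    X.toSimpleGraph.Adj (w • x) (w • y) := by
  rw [toSimpleGraph_adj] at h ⊢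
  obtain ⟨hne, e, he⟩ := h
  refine ⟨fun h => hne (MulAction.injective w h), w • e, ?_⟩
  rw [source_smul, target_smul]
  exact congrArg (Sym2.map (w • ·)) he

variable {X}

theorem IsTree.smul_edge_eq (hX : X.IsTree) {w : W} {e : X.E}
    (h : s(w • X.source e, w • X.target e) = s(X.source e, X.target e)) : w • e = e :=
  hX.edge_ext (by rw [source_smul, target_smul, h])

/-- The action preserves orientation: swapping the ends of an edge would fix that edge, hence fix
its source and target. -/
theorem IsTree.no_inversion (hX : X.IsTree) (w : W) (x y : X.V)
    (h : X.toSimpleGraph.Adj x y) (hxy : w • x = y) : w • y ≠ x := by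
  intro hyx
  obtain ⟨hne, e, he⟩ := X.toSimpleGraph_adj.1 h
  have hwe : w • e = e := by
    refine hX.smul_edge_eq ?_
    have h' := congrArg (Sym2.map (w • ·)) he
    simp only [Sym2.map_mk, hxy, hyx] at h'
    rw [h', he, Sym2.eq_swap]
  have h1 := source_smul w e
  have h2 := target_smul w e
  rw [hwe] at h1 h2
  rcases Sym2.eq_iff.1 he with ⟨h3, -⟩ | ⟨-, h4⟩
  · rw [h3, hxy] at h1; exact hne h1
  · rw [h4, hxy] at h2; exact hne h2

/-- A finite group of automorphisms of a tree that preserves the orientation of the edges fixes a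
vertex. -/
theorem IsTree.exists_fixed_vertex (hX : X.IsTree) (H : Subgroup W) [Finite H] :
    ∃ x : X.V, ∀ w ∈ H, w • x = x := by
  obtain ⟨x, hx⟩ := hX.toSimpleGraph.exists_forall_smul_eq (K := H)
    (fun w => X.smul_adj (w : W)) (fun w => hX.no_inversion (w : W))
  exact ⟨x, fun w hw => hx ⟨w, hw⟩⟩

end Action

end ConnectedMultigraph

/-! ### The visual decomposition from an action on a tree. -/

namespace CoxeterSystem

open ConnectedMultigraph ConnectedMultigraph.GroupAction

variable {B W : Type*} [Group W] {M : CoxeterMatrix B} (cs : CoxeterSystem M W)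
  (X : ConnectedMultigraph) [MulAction W X.V] [MulAction W X.E] [X.GroupAction W]

/-- The special subgroup generated by the simple reflections that fix a given point. -/
def fixerSpecial {α : Type*} [MulAction W α] (a : α) : Subgroup W :=
  Subgroup.closure (cs.simple '' {b | cs.simple b • a = a})

theorem simple_mem_fixerSpecial {α : Type*} [MulAction W α] {a : α} {b : B}
    (h : cs.simple b • a = a) : cs.simple b ∈ cs.fixerSpecial a :=
  Subgroup.subset_closure ⟨b, h, rfl⟩

theorem smul_eq_of_mem_fixerSpecial {α : Type*} [MulAction W α] {a : α} {w : W}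
    (h : w ∈ cs.fixerSpecial a) : w • a = a := by
  have : cs.fixerSpecial a ≤ MulAction.stabilizer W a := by
    rw [fixerSpecial, Subgroup.closure_le]
    rintro _ ⟨b, hb, rfl⟩
    exact hb
  exact this h

theorem fixerSpecial_mono {α β : Type*} [MulAction W α] [MulAction W β] {a : α} {b : β}
    (h : ∀ w : W, w • a = a → w • b = b) : cs.fixerSpecial a ≤ cs.fixerSpecial b :=
  Subgroup.closure_mono (Set.image_mono fun _ hc => h _ hc)

/-- The graph of special subgroups, each generated by the simple reflections that fix a vertex or
edge, of an action of a Coxeter group on a graph. -/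
def fixerGraph : GraphOfSubgroups W where
  toConnectedMultigraph := X
  vertexGroup x := cs.fixerSpecial x
  edgeGroup e := cs.fixerSpecial e
  le_source e := cs.fixerSpecial_mono fun w h => by rw [← source_smul, h]
  le_target e := cs.fixerSpecial_mono fun w h => by rw [← target_smul, h]

/-- The fundamental group of the graph of special subgroups of an action on a tree. -/
abbrev FixerGroup := (cs.fixerGraph X).toGraphOfGroups.FundamentalGroup
  (Set.univ : Set (cs.fixerGraph X).toGraphOfGroups.E)

/-- The canonical homomorphism from a vertex group of the graph of special subgroups to its
fundamental group. -/
def fixerVertexHom (x : X.V) : cs.fixerSpecial x →* cs.FixerGroup X :=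
  (cs.fixerGraph X).toGraphOfGroups.ofVertex _ x

/-- The homomorphism to the Coxeter group that extends the inclusions of the vertex groups. -/
def fixerGroupHom : cs.FixerGroup X →* W :=
  PresentedGroup.toGroup (f := Sum.elim (fun g => Subtype.val (p := (· ∈ cs.fixerSpecial
      (show X.V from g.1))) g.2) fun _ => 1) (by
    rintro _ (⟨x, g, h⟩ | ⟨e, g⟩ | ⟨e, -⟩)
    · simp only [GraphOfGroups.vertexLetter, map_mul, map_inv, FreeGroup.lift_apply_of,
        Sum.elim_inl, mul_inv_eq_one]
      rfl
    · simp only [GraphOfGroups.vertexLetter, GraphOfGroups.edgeLetter, map_mul, map_inv,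
        FreeGroup.lift_apply_of, Sum.elim_inl, Sum.elim_inr, mul_inv_eq_one, mul_one, one_mul]
      rfl
    · simp only [GraphOfGroups.edgeLetter, FreeGroup.lift_apply_of, Sum.elim_inr])

theorem fixerGroupHom_fixerVertexHom (x : X.V) (g : cs.fixerSpecial x) :
    cs.fixerGroupHom X (cs.fixerVertexHom X x g) = g :=
  PresentedGroup.toGroup.of _

/-- Every edge lies in the spanning tree, so its letter is trivial and the edge relation identifies
the two copies of the edge group. -/
theorem fixerVertexHom_source_eq_target (e : X.E) {w : W} (he : w ∈ cs.fixerSpecial e)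
    (hs : w ∈ cs.fixerSpecial (X.source e)) (ht : w ∈ cs.fixerSpecial (X.target e)) :
    cs.fixerVertexHom X (X.source e) ⟨w, hs⟩ = cs.fixerVertexHom X (X.target e) ⟨w, ht⟩ := by
  let L := (cs.fixerGraph X).toGraphOfGroups
  let g : L.vertexGroup (L.source e) := (⟨w, hs⟩ : cs.fixerSpecial (X.source e))
  have h1 := PresentedGroup.one_of_mem (rels := {r | L.Relator Set.univ r})
    (GraphOfGroups.Relator.tree e (Set.mem_univ e))
  have h2 := PresentedGroup.one_of_mem (rels := {r | L.Relator Set.univ r})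
    (GraphOfGroups.Relator.edge e ⟨g, Subgroup.mem_subgroupOf.2 he⟩)
  rw [map_mul, map_inv, mul_inv_eq_one, map_mul, map_mul, h1, mul_one, one_mul] at h2
  exact h2

variable {X}

/-- The fixed vertices are joined by paths of fixed vertices. Each edge on such a path is also
fixed, so its group contains the reflection and identifies the copies at its ends. -/
theorem fixerVertexHom_simple_eq (hX : X.IsTree) (b : B) {x y : X.V}
    (hx : cs.simple b • x = x) (hy : cs.simple b • y = y) :
    cs.fixerVertexHom X x ⟨cs.simple b, cs.simple_mem_fixerSpecial hx⟩ =
      cs.fixerVertexHom X y ⟨cs.simple b, cs.simple_mem_fixerSpecial hy⟩ := by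
  refine hX.toSimpleGraph.fixed_induction (K := W) (k := cs.simple b) X.smul_adj
    (p := fun x y => ∀ (hx : cs.simple b • x = x) (hy : cs.simple b • y = y),
      cs.fixerVertexHom X x ⟨cs.simple b, cs.simple_mem_fixerSpecial hx⟩ =
        cs.fixerVertexHom X y ⟨cs.simple b, cs.simple_mem_fixerSpecial hy⟩) ?_ ?_ hx hy hx hy
  · intros; rfl
  · intro x y z hadj hx hy ih _ hz
    refine Eq.trans ?_ (ih hy hz)
    obtain ⟨-, e, he⟩ := X.toSimpleGraph_adj.1 hadj
    have hfix : cs.simple b • e = e := by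
      refine hX.smul_edge_eq ?_
      have h' := congrArg (Sym2.map (cs.simple b • ·)) he
      simp only [Sym2.map_mk, hx, hy] at h'
      rw [h', he]
    have hmem := cs.simple_mem_fixerSpecial hfix
    rcases Sym2.eq_iff.1 he with ⟨rfl, rfl⟩ | ⟨rfl, rfl⟩
    · exact cs.fixerVertexHom_source_eq_target X e hmem _ _
    · exact (cs.fixerVertexHom_source_eq_target X e hmem _ _).symm

theorem exists_vertex_fixed_by_pair (hX : X.IsTree) (b c : B) (h : M b c ≠ 0) :
    ∃ x : X.V, cs.simple b • x = x ∧ cs.simple c • x = x := by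
  have := Subgroup.finite_closure_pair_of_isOfFinOrder (cs.simple_mul_simple_self b)
    (cs.simple_mul_simple_self c)
    (isOfFinOrder_iff_pow_eq_one.2 ⟨_, Nat.pos_of_ne_zero h, cs.simple_mul_simple_pow b c⟩)
  obtain ⟨x, hx⟩ := hX.exists_fixed_vertex (Subgroup.closure {cs.simple b, cs.simple c})
  exact ⟨x, hx _ (Subgroup.subset_closure (by simp)), hx _ (Subgroup.subset_closure (by simp))⟩

theorem exists_vertex_fixed_by_simple (hX : X.IsTree) (b : B) :
    ∃ x : X.V, cs.simple b • x = x := by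
  obtain ⟨x, hx, -⟩ := cs.exists_vertex_fixed_by_pair hX b b (by simp)
  exact ⟨x, hx⟩

/-- The inverse of `fixerGroupHom` comes from the Coxeter presentation: each simple reflection goes
to its common image from all the vertex groups containing it. -/
theorem exists_fixerGroup_mulEquiv (hX : X.IsTree) :
    ∃ f : cs.FixerGroup X ≃* W, ∀ (x : X.V) (g : cs.fixerSpecial x),
      f (cs.fixerVertexHom X x g) = g := by
  choose v hv using cs.exists_vertex_fixed_by_simple hX
  let j : B → cs.FixerGroup X := fun b =>
    cs.fixerVertexHom X (v b) ⟨cs.simple b, cs.simple_mem_fixerSpecial (hv b)⟩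
  have hj : ∀ b x (hx : cs.simple b • x = x),
      j b = cs.fixerVertexHom X x ⟨cs.simple b, cs.simple_mem_fixerSpecial hx⟩ :=
    fun b x hx => cs.fixerVertexHom_simple_eq hX b (hv b) hx
  have hlift : M.IsLiftable j := by
    intro b c
    -- The entry `0` encodes infinite order, so there is no relation to check.
    by_cases h : M b c = 0
    · rw [h, pow_zero]
    · obtain ⟨x, hb, hc⟩ := cs.exists_vertex_fixed_by_pair hX b c h
      rw [hj b x hb, hj c x hc, ← map_mul, ← map_pow]
      refine (congrArg _ (Subtype.ext ?_)).trans (map_one _)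
      exact cs.simple_mul_simple_pow b c
  have hvert : ∀ (x : X.V) (g : cs.fixerSpecial x), cs.lift ⟨j, hlift⟩ (g : W) =
      cs.fixerVertexHom X x g := by
    rintro x ⟨g, hg⟩
    change g ∈ Subgroup.closure _ at hg
    induction hg using Subgroup.closure_induction with
    | mem g hg =>
      obtain ⟨b, hb, rfl⟩ := hg
      exact (cs.lift_apply_simple hlift b).trans (hj b x hb)
    | one => exact (map_one _).trans (map_one (cs.fixerVertexHom X x)).symm
    | mul g h hg hh ihg ihh =>
      exact (map_mul _ _ _).trans ((congrArg₂ (· * ·) ihg ihh).trans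
        (map_mul (cs.fixerVertexHom X x) _ _).symm)
    | inv g hg ih =>
      exact (map_inv _ _).trans ((congrArg _ ih).trans (map_inv (cs.fixerVertexHom X x) _).symm)
  refine ⟨MonoidHom.toMulEquiv (cs.fixerGroupHom X) (cs.lift ⟨j, hlift⟩) ?_ ?_,
    fun x g => cs.fixerGroupHom_fixerVertexHom X x g⟩
  · refine PresentedGroup.ext ?_
    rintro (⟨x, g⟩ | e)
    · exact (congrArg (cs.lift ⟨j, hlift⟩) (cs.fixerGroupHom_fixerVertexHom X x g)).trans
        (hvert x g)
    · have h1 : (PresentedGroup.of (Sum.inr e) : cs.FixerGroup X) = 1 :=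
        PresentedGroup.one_of_mem (GraphOfGroups.Relator.tree e (Set.mem_univ e))
      rw [h1, map_one, map_one]
  · refine cs.ext_simple fun b => ?_
    rw [MonoidHom.comp_apply, lift_apply_simple, MonoidHom.id_apply]
    exact cs.fixerGroupHom_fixerVertexHom X _ _

/-- For an action of a Coxeter group on a tree, the special subgroups generated by the simple
reflections fixing a vertex or edge form a visual decomposition. -/
theorem isVisualDecomposition_fixerGraph (hX : X.IsTree) :
    (cs.fixerGraph X).IsVisualDecomposition cs where
  vertex_special _ := ⟨_, rfl⟩
  edge_special _ := ⟨_, rfl⟩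
  exists_mulEquiv := ⟨Set.univ, hX, cs.exists_fixerGroup_mulEquiv hX⟩

end CoxeterSystem

/-! ### Edge cochains as coboundaries, by a twisted action. -/

namespace Equiv.Perm

variable {G A : Type*}

/-- The permutation `(g, a) ↦ (h * g, a)` of `G × A`. -/
def leftTranslation [Group G] (A : Type*) (h : G) : Equiv.Perm (G × A) :=
  (Equiv.mulLeft h).prodCongr (Equiv.refl A)

@[simp] theorem leftTranslation_apply [Group G] (h : G) (p : G × A) :
    leftTranslation A h p = (h * p.1, p.2) := rfl

variable [AddCommGroup A]

/-- The permutation `(g, a) ↦ (g, a + u g)` of `G × A`. -/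
def shear (u : G → A) : Equiv.Perm (G × A) where
  toFun p := (p.1, p.2 + u p.1)
  invFun p := (p.1, p.2 - u p.1)
  left_inv p := by simp
  right_inv p := by simp

@[simp] theorem shear_apply (u : G → A) (p : G × A) : shear u p = (p.1, p.2 + u p.1) := rfl

@[simp] theorem shear_symm_apply (u : G → A) (p : G × A) :
    (shear u).symm p = (p.1, p.2 - u p.1) := rfl

end Equiv.Perm

namespace GraphOfGroups

variable (L : GraphOfGroups.{u, v, w}) (T : Set L.E)

/-- The element of the fundamental group given by an edge. -/
def ofEdge (e : L.E) : L.FundamentalGroup T := PresentedGroup.mk {r | L.Relator T r} (L.edgeLetter e)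

variable {L T}

theorem ofEdge_eq_one {e : L.E} (he : e ∈ T) : L.ofEdge T e = 1 :=
  PresentedGroup.one_of_mem (rels := {r | L.Relator T r}) (Relator.tree e he)

theorem ofVertex_mul_ofEdge (e : L.E) (g : L.edgeGroup e) :
    L.ofVertex T (L.source e) g * L.ofEdge T e =
      L.ofEdge T e * L.ofVertex T (L.target e) (L.edgeMap e g) := by
  have h := PresentedGroup.one_of_mem (rels := {r | L.Relator T r}) (Relator.edge e g)
  rwa [map_mul, map_inv, mul_inv_eq_one, map_mul, map_mul] at h

theorem edgeSubgroup_le (e : L.E) : L.edgeSubgroup T e ≤ L.vertexSubgroup T (L.source e) :=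
  Subgroup.map_le_range _ _

theorem conj_mem_vertexSubgroup {e : L.E} {h : L.FundamentalGroup T}
    (hh : h ∈ L.edgeSubgroup T e) :
    (L.ofEdge T e)⁻¹ * h * L.ofEdge T e ∈ L.vertexSubgroup T (L.target e) := by
  obtain ⟨g, hg, rfl⟩ := hh
  refine ⟨L.edgeMap e ⟨g, hg⟩, ?_⟩
  rw [mul_assoc, eq_inv_mul_iff_mul_eq]
  exact (ofVertex_mul_ofEdge e ⟨g, hg⟩).symm

theorem eq_top_of_generators_mem {H : Subgroup (L.FundamentalGroup T)}
    (hv : ∀ x, L.vertexSubgroup T x ≤ H) (he : ∀ e, L.ofEdge T e ∈ H) : H = ⊤ := by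
  rw [Subgroup.eq_top_iff']
  refine PresentedGroup.generated_by _ H ?_
  rintro (⟨x, g⟩ | e)
  · exact hv x ⟨g, rfl⟩
  · exact he e

section Cocycle

open Equiv.Perm

variable {A : Type*} [AddCommGroup A] {c : L.E → L.FundamentalGroup T → A}
  {p : L.V → L.FundamentalGroup T → A}

/-- The action of the fundamental group on `π₁ × A` defined by functions on the edge and vertex
cosets. -/
def twistedAction
    (hc : ∀ e, ∀ h ∈ L.edgeSubgroup T e, ∀ g, c e (h * g) = c e g)
    (hp : ∀ e ∈ T, ∀ g, p (L.target e) g = p (L.source e) g + c e g) :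
    L.FundamentalGroup T →* Equiv.Perm (L.FundamentalGroup T × A) :=
  -- Vertex elements act by conjugated translations, which gives the vertex relations. The edge
  -- relations use the invariance `hc`; triviality of the tree letters is exactly `hp`.
  PresentedGroup.toGroup
    (f := Sum.elim
      (fun g => (shear (p g.1))⁻¹ * leftTranslation A (L.ofVertex T g.1 g.2) * shear (p g.1))
      (fun e => (shear (p (L.source e)))⁻¹ * (shear (c e))⁻¹ *
        leftTranslation A (L.ofEdge T e) * shear (p (L.target e)))) (by
    rintro _ (⟨x, g, h⟩ | ⟨e, g⟩ | ⟨e, he⟩)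
    · simp only [vertexLetter, map_mul, map_inv, FreeGroup.lift_apply_of, Sum.elim_inl,
        mul_inv_eq_one]
      ext q <;> simp [mul_assoc]
    · simp only [vertexLetter, edgeLetter, map_mul, map_inv, FreeGroup.lift_apply_of,
        Sum.elim_inl, Sum.elim_inr, mul_inv_eq_one]
      have h1 := fun k => hc e _ ⟨g, g.2, rfl⟩ k
      have h2 := fun k => congrArg (· * k) (ofVertex_mul_ofEdge (T := T) e g)
      simp only [mul_assoc] at h2
      ext q <;> simp [← h2, h1]
    · simp only [edgeLetter, FreeGroup.lift_apply_of, Sum.elim_inr]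
      ext q
      · simp [ofEdge_eq_one he]
      · simp only [Equiv.Perm.mul_apply, Equiv.Perm.coe_inv, shear_apply, leftTranslation_apply,
          shear_symm_apply, ofEdge_eq_one he, hp e he, Equiv.Perm.one_apply, one_mul]
        abel)

/-- Functions on the edges of the Bass–Serre tree are coboundaries. -/
theorem exists_potential
    (hc : ∀ e, ∀ h ∈ L.edgeSubgroup T e, ∀ g, c e (h * g) = c e g)
    (hp : ∀ e ∈ T, ∀ g, p (L.target e) g = p (L.source e) g + c e g) :
    ∃ F : L.FundamentalGroup T → A,
      (∀ x, ∀ h ∈ L.vertexSubgroup T x, ∀ g, F (h * g) + p x (h * g) = F g + p x g) ∧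
      ∀ e g, F (L.ofEdge T e * g) + p (L.source e) (L.ofEdge T e * g) +
        c e (L.ofEdge T e * g) = F g + p (L.target e) g := by
  let ρ := twistedAction hc hp
  have hv : ∀ x (h : L.vertexGroup x), ρ (L.ofVertex T x h) =
      (shear (p x))⁻¹ * leftTranslation A (L.ofVertex T x h) * shear (p x) :=
    fun x h => PresentedGroup.toGroup.of _
  have he : ∀ e, ρ (L.ofEdge T e) = (shear (p (L.source e)))⁻¹ * (shear (c e))⁻¹ *
        leftTranslation A (L.ofEdge T e) * shear (p (L.target e)) :=
    fun e => PresentedGroup.toGroup.of _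
  -- The action covers left translation on the first factor. It suffices to see this on generators.
  let H : Subgroup (L.FundamentalGroup T) :=
    { carrier := {g | ∀ q, (ρ g q).1 = g * q.1}
      one_mem' := by simp
      mul_mem' := by
        intro a b ha hb q
        rw [map_mul, Equiv.Perm.mul_apply, ha, hb, mul_assoc]
      inv_mem' := by
        intro a ha q
        have := ha (ρ a⁻¹ q)
        rw [← Equiv.Perm.mul_apply, ← map_mul, mul_inv_cancel, map_one, Equiv.Perm.one_apply]
          at this
        rw [this, inv_mul_cancel_left] }
  have hH : H = ⊤ := by
    refine eq_top_of_generators_mem ?_ ?_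
    · rintro x _ ⟨h, rfl⟩ q
      simp [hv]
    · intro e q
      simp [he]
  have hfst : ∀ g, (ρ g (1, 0)).1 = g := by
    intro g
    have : g ∈ H := hH ▸ Subgroup.mem_top g
    simpa using this (1, 0)
  -- The orbit of `(1, 0)` is the graph of a function. The formulas for the generators are its
  -- transformation rules.
  refine ⟨fun g => (ρ g (1, 0)).2, ?_, ?_⟩
  · rintro x _ ⟨h, rfl⟩ g
    simp [hv, hfst]
  · intro e g
    simp [he, hfst]

end Cocycle

end GraphOfGroups

/-! ### Recognizing trees by cuts. -/

namespace ConnectedMultigraph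

/-- A connected multigraph is a tree if every edge is the only one that joins the two parts of some
partition of the vertices. -/
theorem isTree_of_exists_cut (X : ConnectedMultigraph)
    (h : ∀ e : X.E, ∃ f : X.V → Prop, ¬ (f (X.source e) ↔ f (X.target e)) ∧
      ∀ d, d ≠ e → (f (X.source d) ↔ f (X.target d))) : X.IsTree where
  no_loops e _ heq := by
    obtain ⟨f, hf, -⟩ := h e
    exact hf (by rw [heq])
  no_multiple := by
    intro d _ e _ hde
    by_contra hne
    obtain ⟨f, hf, hf'⟩ := h e
    have := hf' d hne
    rcases Sym2.eq_iff.1 hde with ⟨h1, h2⟩ | ⟨h1, h2⟩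
    · rw [h1, h2] at this; exact hf this
    · rw [h1, h2] at this; exact hf this.symm
  isTree := by
    refine ⟨by simpa using X.connected, ?_⟩
    rw [SimpleGraph.isAcyclic_iff_forall_adj_isBridge]
    simp only [Set.mem_univ, true_and]
    change ∀ x y, X.toSimpleGraph.Adj x y → X.toSimpleGraph.IsBridge s(x, y)
    intro x y hxy
    obtain ⟨-, e, he⟩ := X.toSimpleGraph_adj.1 hxy
    obtain ⟨f, hf, hf'⟩ := h e
    rw [SimpleGraph.isBridge_iff]
    rintro ⟨w⟩
    -- Away from `e` the side of the cut never changes, so no walk avoiding `e` joins its ends.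
    have key : ∀ {a b : X.V}, (X.toSimpleGraph.deleteEdges {s(x, y)}).Walk a b →
        (f a ↔ f b) := by
      intro a b w
      induction w with
      | nil => exact Iff.rfl
      | cons hadj _ ih =>
        refine Iff.trans ?_ ih
        rw [SimpleGraph.deleteEdges_adj, Set.mem_singleton_iff, toSimpleGraph_adj] at hadj
        obtain ⟨⟨-, d, hd⟩, hne⟩ := hadj
        have hde := hf' d (by rintro rfl; exact hne (hd.symm.trans he))
        rcases Sym2.eq_iff.1 hd with ⟨h1, h2⟩ | ⟨h1, h2⟩
        · rwa [h1, h2] at hde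
        · rw [h1, h2] at hde; exact hde.symm
    have hxy' := key w
    rcases Sym2.eq_iff.1 he with ⟨h1, h2⟩ | ⟨h1, h2⟩
    · rw [h1, h2] at hf; exact hf hxy'
    · rw [h1, h2] at hf; exact hf hxy'.symm

end ConnectedMultigraph

/-! ### The Bass–Serre tree. -/

namespace GraphOfGroups

variable (L : GraphOfGroups.{u, v, w}) (T : Set L.E)

/-- The vertices of the Bass–Serre tree: the cosets of the vertex groups. -/
abbrev CosetVertex : Type max u v w := Σ x : L.V, L.FundamentalGroup T ⧸ L.vertexSubgroup T x

/-- The edges of the Bass–Serre tree: the cosets of the edge groups. -/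
abbrev CosetEdge : Type max u v w := Σ e : L.E, L.FundamentalGroup T ⧸ L.edgeSubgroup T e

variable {L T}

/-- The vertex of the Bass–Serre tree given by a vertex and a group element. -/
abbrev cosetVertex (x : L.V) (g : L.FundamentalGroup T) : L.CosetVertex T := ⟨x, g⟩

/-- The originating vertex of a coset of an edge group. -/
def cosetSource (q : L.CosetEdge T) : L.CosetVertex T :=
  ⟨L.source q.1, Quotient.map' id (fun a b h => by
    rw [QuotientGroup.leftRel_apply] at h ⊢
    exact edgeSubgroup_le _ h) q.2⟩

/-- The terminating vertex of a coset of an edge group. -/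
def cosetTarget (q : L.CosetEdge T) : L.CosetVertex T :=
  ⟨L.target q.1, Quotient.map' (· * L.ofEdge T q.1) (fun a b h => by
    rw [QuotientGroup.leftRel_apply] at h ⊢
    simpa [mul_assoc] using conj_mem_vertexSubgroup h) q.2⟩

theorem cosetVertex_mul_eq {x : L.V} (g : L.FundamentalGroup T) {h : L.FundamentalGroup T}
    (hh : h ∈ L.vertexSubgroup T x) : cosetVertex x (g * h) = cosetVertex x g :=
  congrArg (Sigma.mk x) (QuotientGroup.mk_mul_of_mem g hh)

/-- Each translate of the spanning tree is connected. Right multiplication by a generator leads to a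
translate joined to the first by a shared vertex or by an edge. -/
theorem coset_connected (hT : L.IsSpanningTree T) :
    (SimpleGraph.fromRel fun x y : L.CosetVertex T =>
      ∃ e : L.CosetEdge T, cosetSource e = x ∧ cosetTarget e = y).Connected := by
  set S := SimpleGraph.fromRel fun x y : L.CosetVertex T =>
      ∃ e : L.CosetEdge T, cosetSource e = x ∧ cosetTarget e = y
  have hedge : ∀ e g, S.Reachable (cosetVertex (L.source e) g)
      (cosetVertex (L.target e) (g * L.ofEdge T e)) := by
    intro e g
    by_cases h : cosetVertex (L.source e) g = cosetVertex (L.target e) (g * L.ofEdge T e)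
    · rw [h]
    · exact SimpleGraph.Adj.reachable
        ((SimpleGraph.fromRel_adj _ _ _).2 ⟨h, Or.inl ⟨⟨e, g⟩, rfl, rfl⟩⟩)
  have hbase : ∀ x y g, S.Reachable (cosetVertex x g) (cosetVertex y g) := by
    intro x y g
    obtain ⟨p⟩ := hT.isTree.connected x y
    induction p with
    | nil => exact .rfl
    | cons hadj _ ih =>
      refine SimpleGraph.Reachable.trans ?_ ih
      obtain ⟨-, ⟨e, he, rfl, rfl⟩ | ⟨e, he, rfl, rfl⟩⟩ := (SimpleGraph.fromRel_adj _ _ _).1 hadj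
      · simpa [ofEdge_eq_one he] using hedge e g
      · simpa [ofEdge_eq_one he] using (hedge e g).symm
  let H : Subgroup (L.FundamentalGroup T) :=
    { carrier := {h | ∀ g x, S.Reachable (cosetVertex x (g * h)) (cosetVertex x g)}
      one_mem' := fun g x => by rw [mul_one]
      mul_mem' := fun {a b} ha hb g x => by
        rw [← mul_assoc]
        exact (hb _ x).trans (ha g x)
      inv_mem' := fun {a} ha g x => by simpa using (ha (g * a⁻¹) x).symm }
  have hH : H = ⊤ := by
    refine eq_top_of_generators_mem ?_ ?_
    · intro y h hh g x
      have h1 := hbase y x g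
      rw [← cosetVertex_mul_eq g hh] at h1
      exact (hbase x y _).trans (h1.trans .rfl)
    · intro e g x
      exact (hbase x (L.target e) _).trans ((hedge e g).symm.trans (hbase _ _ _))
  obtain ⟨x₀⟩ := hT.isTree.connected.nonempty
  have hreach : ∀ y, S.Reachable y (cosetVertex x₀ 1) := by
    rintro ⟨x, q⟩
    induction q using QuotientGroup.induction_on with
    | H g =>
      have hg : g ∈ H := hH ▸ Subgroup.mem_top g
      have := hg 1 x
      rw [one_mul] at this
      exact this.trans (hbase _ _ _)
  have : Nonempty (L.CosetVertex T) := ⟨cosetVertex x₀ 1⟩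
  exact ⟨fun y z => (hreach y).trans (hreach z).symm⟩

/-- The Bass–Serre tree of a graph of groups. -/
def bassSerreTree (hT : L.IsSpanningTree T) : ConnectedMultigraph.{max u v w, max u v w} where
  V := L.CosetVertex T
  E := L.CosetEdge T
  source := cosetSource
  target := cosetTarget
  connected := coset_connected hT

open Classical in
/-- A potential on a spanning tree for a function supported on the cosets of a single edge. -/
theorem exists_spanningTree_potential (hT : L.IsSpanningTree T) {A : Type*} [AddCommGroup A]
    (e₀ : L.E) (a : L.FundamentalGroup T → A) :
    ∃ p : L.V → L.FundamentalGroup T → A, ∀ e ∈ T, ∀ g,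
      p (L.target e) g = p (L.source e) g + if e = e₀ then a g else 0 := by
  by_cases h₀ : e₀ ∈ T
  · set S := SimpleGraph.fromRel fun x y => ∃ e ∈ T, L.source e = x ∧ L.target e = y with hS
    set R := S.deleteEdges {s(L.source e₀, L.target e₀)}
    have hadj : ∀ e ∈ T, S.Adj (L.source e) (L.target e) := fun e he =>
      (SimpleGraph.fromRel_adj _ _ _).2 ⟨hT.no_loops e he, Or.inl ⟨e, he, rfl, rfl⟩⟩
    have hbridge : ¬ R.Reachable (L.source e₀) (L.target e₀) :=
      SimpleGraph.isBridge_iff.1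
        (SimpleGraph.isAcyclic_iff_forall_adj_isBridge.1 hT.isTree.isAcyclic (hadj e₀ h₀))
    -- Removing `e₀` splits the spanning tree; the potential is `a` on the target side and zero on
    -- the other.
    refine ⟨fun x g => if R.Reachable x (L.target e₀) then a g else 0, fun e he g => ?_⟩
    by_cases hee : e = e₀
    · subst hee
      simp [hbridge]
    · have hR : R.Adj (L.source e) (L.target e) := by
        rw [SimpleGraph.deleteEdges_adj]
        exact ⟨hadj e he, fun h => hee (hT.no_multiple he h₀ h)⟩
      have : R.Reachable (L.source e) (L.target e₀) ↔ R.Reachable (L.target e) (L.target e₀) :=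
        ⟨hR.symm.reachable.trans, hR.reachable.trans⟩
      simp [hee, this]
  · refine ⟨fun _ _ => 0, fun e he g => ?_⟩
    have : e ≠ e₀ := by rintro rfl; exact h₀ he
    simp [this]

open Classical in
theorem isTree_bassSerreTree (hT : L.IsSpanningTree T) : (bassSerreTree hT).IsTree := by
  refine ConnectedMultigraph.isTree_of_exists_cut _ ?_
  rintro ⟨e₀, q₀⟩
  obtain ⟨k, rfl⟩ := QuotientGroup.mk_surjective q₀
  -- Cochains are invariant under left multiplication, whereas the tree consists of left cosets.
  -- Hence the inversion: `a g⁻¹` is the indicator of the coset of `k`. Modulo 2, adding `1` always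
  -- switches sides of the cut.
  let a : L.FundamentalGroup T → ZMod 2 := fun g => if g * k ∈ L.edgeSubgroup T e₀ then 1 else 0
  obtain ⟨p, hp⟩ := exists_spanningTree_potential hT e₀ a
  obtain ⟨F, hF₁, hF₂⟩ := exists_potential
    (c := fun e g => if e = e₀ then a g else 0) (p := p) (by
      intro e h hh g
      by_cases he : e = e₀
      · subst he
        simp only [a, if_true, mul_assoc, Subgroup.mul_mem_cancel_left _ hh]
      · simp [he]) hp
  let f : L.CosetVertex T → ZMod 2 := fun x => Quotient.liftOn' x.2
    (fun g => F g⁻¹ + p x.1 g⁻¹) (by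
      intro g h hgh
      rw [QuotientGroup.leftRel_apply] at hgh
      simpa using (hF₁ x.1 _ (inv_mem hgh) g⁻¹).symm)
  have hf : ∀ e (g : L.FundamentalGroup T), f (cosetTarget ⟨e, g⟩) = f (cosetSource ⟨e, g⟩) +
      if e = e₀ then a g⁻¹ else 0 := by
    intro e g
    have := hF₂ e (g * L.ofEdge T e)⁻¹
    rw [mul_inv_rev, mul_inv_cancel_left, ← mul_inv_rev] at this
    exact this.symm
  refine ⟨fun x => f x = 0, ?_, ?_⟩
  · change ¬ (f (cosetSource ⟨e₀, k⟩) = 0 ↔ f (cosetTarget ⟨e₀, k⟩) = 0)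
    have h1 : a k⁻¹ = 1 := by simp [a, one_mem]
    rw [hf, if_pos rfl, h1]
    generalize f (cosetSource ⟨e₀, k⟩) = z
    revert z
    decide
  · rintro ⟨e, q⟩ hne
    obtain ⟨g, rfl⟩ := QuotientGroup.mk_surjective q
    change f (cosetSource ⟨e, g⟩) = 0 ↔ f (cosetTarget ⟨e, g⟩) = 0
    rw [hf]
    by_cases he : e = e₀
    · subst he
      have h1 : g⁻¹ * k ∉ L.edgeSubgroup T e := fun h =>
        hne (congrArg (Sigma.mk e) (QuotientGroup.eq.2 h))
      simp [a, h1]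
    · simp [he]

section Action

variable {W : Type*} [Group W] (i : W →* L.FundamentalGroup T) (hT : L.IsSpanningTree T)

/-- The action on the vertices of the Bass–Serre tree through a homomorphism to the fundamental
group. -/
abbrev vertexAction : MulAction W (bassSerreTree hT).V :=
  MulAction.compHom (L.CosetVertex T) i

/-- The action on the edges of the Bass–Serre tree through a homomorphism to the fundamental
group. -/
abbrev edgeAction : MulAction W (bassSerreTree hT).E :=
  MulAction.compHom (L.CosetEdge T) i

theorem groupAction_bassSerreTree :
    letI := vertexAction i hT
    letI := edgeAction i hT
    (bassSerreTree hT).GroupAction W := by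
  let _ := vertexAction i hT
  let _ := edgeAction i hT
  constructor
  · rintro w ⟨e, q⟩
    obtain ⟨g, rfl⟩ := QuotientGroup.mk_surjective q
    rfl
  · rintro w ⟨e, q⟩
    obtain ⟨g, rfl⟩ := QuotientGroup.mk_surjective q
    change cosetVertex (L.target e) (i w * g * L.ofEdge T e) =
      cosetVertex (L.target e) (i w * (g * L.ofEdge T e))
    rw [mul_assoc]

end Action

end GraphOfGroups

/-! ### Stabilizers of cosets and the main theorem. -/

/-- The elements fixing a coset of `K` lie in a conjugate of `K`. -/
theorem Subgroup.mem_map_conj_iff_smul_coset {G : Type*} [Group G] {K : Subgroup G} (g h : G) :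
    h ∈ K.map (MulAut.conj g).toMonoidHom ↔ h • (g : G ⧸ K) = g := by
  rw [eq_comm, MulAction.Quotient.smul_mk, QuotientGroup.eq, smul_eq_mul]
  constructor
  · rintro ⟨k, hk, rfl⟩
    simpa [mul_assoc] using hk
  · intro hk
    exact ⟨_, hk, by simp [mul_assoc]⟩

theorem theorem1 {B : Type b} {W : Type k} [Group W] {M : CoxeterMatrix B}
    (cs : CoxeterSystem M W) (L : GraphOfGroups.{u, v, w})
    (T : Set L.E) (hT : L.IsSpanningTree T)
    (i : W →* L.FundamentalGroup T) (hi : Function.Injective i) :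
    ∃ P : GraphOfSubgroups.{max u v w, max u v w, k} W,
      P.IsVisualDecomposition cs ∧
      (∀ x : P.V, ∃ y : L.V,
        ((P.vertexGroup x).map i).LiesInConjugate (L.vertexSubgroup T y)) ∧
      (∀ e : P.E, ∃ d : L.E,
        ((P.edgeGroup e).map i).LiesInConjugate (L.edgeSubgroup T d)) ∧
      (∀ H : Subgroup W, cs.IsSpecial H →
        (∃ y : L.V, (H.map i).LiesInConjugate (L.vertexSubgroup T y)) →
        ∃ x : P.V, H ≤ P.vertexGroup x) := by
  let _ := GraphOfGroups.vertexAction i hT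
  let _ := GraphOfGroups.edgeAction i hT
  have _ := GraphOfGroups.groupAction_bassSerreTree i hT
  refine ⟨cs.fixerGraph (GraphOfGroups.bassSerreTree hT),
    cs.isVisualDecomposition_fixerGraph (GraphOfGroups.isTree_bassSerreTree hT), ?_, ?_, ?_⟩
  · rintro ⟨y, q⟩
    obtain ⟨g, rfl⟩ := QuotientGroup.mk_surjective q
    refine ⟨y, g, ?_⟩
    rintro _ ⟨w, hw, rfl⟩
    rw [Subgroup.mem_map_conj_iff_smul_coset]
    have h : i w • GraphOfGroups.cosetVertex y g = GraphOfGroups.cosetVertex y g :=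
      cs.smul_eq_of_mem_fixerSpecial hw
    exact eq_of_heq (Sigma.mk.inj h).2
  · rintro ⟨d, q⟩
    obtain ⟨g, rfl⟩ := QuotientGroup.mk_surjective q
    refine ⟨d, g, ?_⟩
    rintro _ ⟨w, hw, rfl⟩
    rw [Subgroup.mem_map_conj_iff_smul_coset]
    have h : i w • (⟨d, g⟩ : L.CosetEdge T) = ⟨d, g⟩ := cs.smul_eq_of_mem_fixerSpecial hw
    exact eq_of_heq (Sigma.mk.inj h).2
  · rintro _ ⟨J, rfl⟩ ⟨y, g, hg⟩
    -- The conjugate of the vertex group by `g` is the stabilizer of this coset, so every generator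
    -- in `J` fixes it.
    refine ⟨GraphOfGroups.cosetVertex y g, Subgroup.closure_mono (Set.image_mono fun b hb => ?_)⟩
    have h := hg (Subgroup.mem_map_of_mem i (Subgroup.subset_closure ⟨b, hb, rfl⟩))
    rw [Subgroup.mem_map_conj_iff_smul_coset] at h
    exact congrArg (Sigma.mk y) h
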